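/- For $n\ge 1$ let $A_n=\{0,\dots,n\}$ and let $\tau_n:A_n\to A_n^3$ be the substitution $\tau_n(a)=a\,0\,(a+1)$ for $a\ne n$, $\tau_n(n)=n\,0\,n$, extended by concatenation to words and to two-sided sequences. Let $X_n\subseteq A_n^{\mathbb Z}$ be the subshift generated by $\tau_n$ (the two-sided sequences all of whose finite subwords occur in words $\tau_n^k(a)$, $k\ge 0$, $a\in A_n$), with the shift $T_n$, and let $\rho_n:X_{n+1}\to X_n$ be the letter-to-letter map induced by $\rho_n(a)=a$ for $a\ne n+1$, $\rho_n(n+1)=n$. Let $$X=\Big\{(x_n)_{n\ge1}\in\prod_{n\ge1}X_n:\ \rho_n(x_{n+1})=x_n\ \text{ for all } n\ge1\Big\},\qquad T\big((x_n)_{n\ge 1}\big)=(T_n x_n)_{n\ge 1}.$$ For every $n\ge 1$ and $x\in X_n$ there is a unique sequence $(\delta_i)_{i\ge0}$ in $\{0,1,2\}$ for which there are points $x^{(0)}=x,\,x^{(1)},\,x^{(2)},\dots$ of $X_n$ with $\tau_n(x^{(i+1)})=T_n^{-\delta_i}x^{(i)}$ for all $i\ge0$; put $\pi_n(x)=\sum_{i\ge0}\delta_i3^i\in\mathcal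 O_3$, where the $3$-odometer $\mathcal O_3=\varprojlim \mathbb Z/3^k\mathbb Z$ (the $3$-adic integers) carries the map $z\mapsto z+1$. For $(x_n)\in X$ the value $\pi_n(x_n)$ does not depend on $n$, and $\pi:X\to\mathcal O_3$, $\pi((x_n)_{n\ge 1})=\pi_n(x_n)$, is a factor map: it is continuous and onto, and $\pi(Tx)=\pi(x)+1$. **Proposition.** The map $\pi:X\to\mathcal O_3$ is at most countable-to-one: $\pi^{-1}(\{z\})$ is finite or countable for every $z\in\mathcal O_3$. Hence every scrambled set of $(X,T)$ is finite or countable, where for a metric $\varrho$ on $X$ compatible with the product topology a set $S\subseteq X$ is called scrambled if $\limsup_{k\to\infty}\varrho(T^kx,T^ky)>0$ and $\liminf_{k\to\infty}\varrho(T^kx,T^ky)=0$ for all distinct $x,y\in S$. -/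

import Mathlib

open Filter Topology

namespace SubstInvLim

/-! ### Li-Yorke pairs and scrambled sets -/

/-- `{x, y}` is a Li-Yorke pair of `(X, T)` for the metric `m`: the distances of the `n`-th iterates
have positive limsup and zero liminf. The distance is read in `[0, ∞]`, so that both limits are
always meaningful. -/
def IsLiYorkePair {X : Type*} (m : MetricSpace X) (T : X → X) (x y : X) : Prop :=
  0 < limsup (fun n : ℕ => edist (T^[n] x) (T^[n] y)) atTop ∧
    liminf (fun n : ℕ => edist (T^[n] x) (T^[n] y)) atTop = 0

/-- A scrambled set: any two distinct points form a Li-Yorke pair. -/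
def IsScrambled {X : Type*} (m : MetricSpace X) (T : X → X) (S : Set X) : Prop :=
  S.Pairwise (IsLiYorkePair m T)

/-- The metric `m` is compatible with the topology `t`. -/
def IsCompatible {X : Type*} (m : MetricSpace X) (t : TopologicalSpace X) : Prop :=
  m.toPseudoMetricSpace.toUniformSpace.toTopologicalSpace = t

/-! ### Substitutions of constant length three -/

/-- The shift map `T` on two-sided sequences. -/
def shift {A : Type*} (x : ℤ → A) : ℤ → A := fun i => x (i + 1)

/-- Extension of a substitution `τ : A → A³` to words by concatenation. -/
def onWord {A : Type*} (τ : A → Fin 3 → A) (w : List A) : List A :=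
  w.flatMap fun a => List.ofFn (τ a)

/-- Extension of a substitution `τ : A → A³` to two-sided sequences,
`τ(x) = … τ(x₋₂) τ(x₋₁) . τ(x₀) τ(x₁) …`: the letter in position `3 q + r`, `0 ≤ r < 3`, is the
`r`-th letter of `τ(x_q)`. -/
def onSeq {A : Type*} (τ : A → Fin 3 → A) (x : ℤ → A) : ℤ → A :=
  fun i => τ (x (i / 3)) ⟨(i % 3).toNat, by omega⟩

/-- The word `x_i x_{i+1} … x_{i+l-1}`. -/
def subword {A : Type*} (x : ℤ → A) (i : ℤ) (l : ℕ) : List A :=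
  List.ofFn fun j : Fin l => x (i + (j : ℕ))

/-- The subshift `X_τ`: all two-sided sequences each of whose finite subwords occurs in some word
`τ^k(a)`. -/
def substShift {A : Type*} (τ : A → Fin 3 → A) : Set (ℤ → A) :=
  {x | ∀ (i : ℤ) (l : ℕ), ∃ (k : ℕ) (a : A), subword x i l <:+: (onWord τ)^[k] [a]}

theorem shift_mem_substShift {A : Type*} {τ : A → Fin 3 → A} {x : ℤ → A}
    (hx : x ∈ substShift τ) : shift x ∈ substShift τ := by
  intro i l
  obtain ⟨k, a, h⟩ := hx (i + 1) l
  refine ⟨k, a, ?_⟩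
  have e : subword (shift x) i l = subword x (i + 1) l := by
    unfold subword shift
    congr 1
    funext j
    congr 1
    ring
  rw [e]
  exact h

/-- `δ` is the sequence of base-three digits attached to the point `x` of `X_τ`: there are points
`x^{(0)} = x, x^{(1)}, x^{(2)}, …` of `X_τ` with `x^{(i)} = T^{δ_i} (τ (x^{(i+1)}))`, that is,
`τ (x^{(i+1)}) = T^{-δ_i} (x^{(i)})`. -/
def IsDigitSeq {A : Type*} (τ : A → Fin 3 → A) (x : ℤ → A) (δ : ℕ → Fin 3) : Prop :=
  ∃ y : ℕ → ℤ → A, y 0 = x ∧ (∀ i, y i ∈ substShift τ) ∧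
    ∀ i, y i = shift^[(δ i : ℕ)] (onSeq τ (y (i + 1)))

/-! ### The systems `X_n` and their inverse limit -/

/-- `τ_n(a) = a 0 (a+1)` if `a ≠ n`, and `τ_n(n) = n 0 n`, on the alphabet `{0, …, n}`. -/
def tau (n : ℕ) (a : Fin (n + 1)) : Fin 3 → Fin (n + 1) :=
  ![a, 0, if h : (a : ℕ) < n then ⟨a + 1, by omega⟩ else Fin.last n]

/-- `ρ_n : {0, …, n+1} → {0, …, n}` fixes the letters other than `n + 1` and sends `n + 1` to
`n`. -/
def rho (n : ℕ) (a : Fin (n + 1 + 1)) : Fin (n + 1) :=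
  if h : (a : ℕ) < n + 1 then ⟨a, h⟩ else Fin.last n

/-- The inverse limit `X` of the `X_n`, `n ≥ 1`, as a subspace of the product. The factors are
indexed by `k = n - 1`: the coordinate `x k` is the point `x_{k+1}` of `X_{k+1}`. -/
def invLimit : Set (∀ k : ℕ, ℤ → Fin (k + 1 + 1)) :=
  {x | (∀ k, x k ∈ substShift (tau (k + 1))) ∧
    ∀ k, (fun i => rho (k + 1) (x (k + 1) i)) = x k}

/-- The map `T` on the inverse limit: the shift in every coordinate. -/
def invShift (x : invLimit) : invLimit :=
  ⟨fun k => shift (x.1 k), fun k => shift_mem_substShift (x.2.1 k), fun k => by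
    funext i
    exact congrFun (x.2.2 k) (i + 1)⟩

end SubstInvLim

/-!
The middle letter of a block `a 0 (a + 1)` is `0` and the last one is not, so the letter `0`
marks the blocks: desubstitution is unique and continuous, and it yields the digits. The address
of position `j` (its place within the blocks of the successive levels) is the digit sequence of
the `j`-th translate, so it is the expansion of `z + j`, where `z` is the value of the point.

Going down one level, an address digit `0`, `1`, `2` copies the letter, replaces it by `0`, or
raises it by one, truncated at `n`. If the address of `j` is not eventually `0`, that is, if
`z + j` is not in `ℕ`, the address therefore determines the letter at `j`. The positions with
`z + j` in `ℕ` lie in blocks `τ^k(a)` which begin at `-z`, so their letters depend on the letter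
`a` at `-z` alone. Hence a point of the inverse limit is determined by `z` and, if `z ∈ ℤ`, by
its sequence of letters at `-z`. Such a compatible sequence consists of the truncations of one
element of `ℕ ∪ {∞}`, so the fibres are countable.

Finally, a continuous map to an isometric system identifies the points of a Li-Yorke pair, so a
scrambled set lies in a single fibre.
-/

namespace SubstInvLim

section Words

variable {A B : Type*} {τ : A → Fin 3 → A} {σ : B → Fin 3 → B} {f : A → B} {x y : ℤ → A}

theorem shift_iterate_apply (x : ℤ → A) (n : ℕ) (i : ℤ) : shift^[n] x i = x (i + n) := by
  induction n generalizing x with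
  | zero => simp
  | succ n ih =>
    rw [Function.iterate_succ_apply, ih, shift]
    push_cast
    ring_nf

theorem exists_eq_three_mul_add (i : ℤ) : ∃ (q : ℤ) (r : Fin 3), i = 3 * q + r :=
  ⟨i / 3, ⟨(i % 3).toNat, by omega⟩, by simp only; omega⟩

theorem onSeq_apply (τ : A → Fin 3 → A) (x : ℤ → A) (q : ℤ) (r : Fin 3) :
    onSeq τ x (3 * q + r) = τ (x q) r := by
  have hdiv : (3 * q + (r : ℤ)) / 3 = q := by omega
  have hmod : ((3 * q + (r : ℤ)) % 3).toNat = r := by omega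
  simp only [onSeq, hdiv, hmod]

theorem eq_shift_iterate_onSeq_iff {d : ℕ} :
    x = shift^[d] (onSeq τ y) ↔
      ∀ (i q : ℤ) (r : Fin 3), i + d = 3 * q + r → x i = τ (y q) r := by
  constructor
  · rintro rfl i q r h
    rw [shift_iterate_apply, h, onSeq_apply]
  · intro h
    funext i
    obtain ⟨q, r, hqr⟩ := exists_eq_three_mul_add (i + d)
    rw [shift_iterate_apply, hqr, onSeq_apply, h i q r hqr]

theorem map_onWord_iterate (hf : ∀ a r, f (τ a r) = σ (f a) r) (k : ℕ) (w : List A) :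
    ((onWord τ)^[k] w).map f = (onWord σ)^[k] (w.map f) := by
  have map_onWord : Function.Semiconj (List.map f) (onWord τ) (onWord σ) := fun w => by
    simp only [onWord, List.map_flatMap, List.flatMap_map, List.map_ofFn, Function.comp_def, hf]
  exact map_onWord.iterate_right k w

theorem comp_mem_substShift (hf : ∀ a r, f (τ a r) = σ (f a) r) (hx : x ∈ substShift τ) :
    f ∘ x ∈ substShift σ := by
  intro i l
  obtain ⟨k, a, h⟩ := hx i l
  refine ⟨k, f a, ?_⟩
  have hmap := h.map f
  rwa [subword, List.map_ofFn, map_onWord_iterate hf] at hmap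

theorem translate_mem_substShift (hx : x ∈ substShift τ) (j : ℤ) :
    (fun i => x (i + j)) ∈ substShift τ := by
  intro i l
  simpa only [subword, add_right_comm] using hx (i + j) l

theorem isClosed_substShift [TopologicalSpace A] [DiscreteTopology A] (τ : A → Fin 3 → A) :
    IsClosed (substShift τ) := by
  have heq : substShift τ = ⋂ (i : ℤ) (l : ℕ),
      (fun (x : ℤ → A) (j : Fin l) => x (i + (j : ℕ))) ⁻¹'
        {u | ∃ (k : ℕ) (a : A), List.ofFn u <:+: (onWord τ)^[k] [a]} := by
    ext x
    simp only [substShift, subword, Set.mem_iInter, Set.mem_preimage, Set.mem_ofPred_eq]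
  rw [heq]
  refine isClosed_iInter fun i => isClosed_iInter fun l => (isClosed_discrete _).preimage ?_
  fun_prop

/-- The letters of a word, at integer positions: `none` outside the word. With signed positions,
windows around a position can be moved without side conditions. -/
def letterAt (w : List A) : ℤ → Option A
  | .ofNat m => w[m]?
  | .negSucc _ => none

theorem letterAt_natCast (w : List A) (m : ℕ) : letterAt w m = w[m]? := rfl

theorem letterAt_of_neg (w : List A) {i : ℤ} (hi : i < 0) : letterAt w i = none := by
  cases i with
  | ofNat m => exact absurd hi (by simp)
  | negSucc m => rfl

theorem bounds_of_letterAt_eq_some {w : List A} {i : ℤ} {a : A} (h : letterAt w i = some a) :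
    0 ≤ i ∧ i < w.length := by
  cases i with
  | ofNat m =>
    obtain ⟨hm, -⟩ := List.getElem?_eq_some_iff.1 h
    exact ⟨by simp, by simpa using hm⟩
  | negSucc m => cases h

theorem getElem?_onWord (τ : A → Fin 3 → A) (w : List A) (q : ℕ) (r : Fin 3) :
    (onWord τ w)[3 * q + r]? = w[q]?.map (τ · r) := by
  induction w generalizing q with
  | nil => simp [onWord]
  | cons a w ih =>
    have hcons : onWord τ (a :: w) = List.ofFn (τ a) ++ onWord τ w := List.flatMap_cons
    rw [hcons]
    cases q with
    | zero =>
      rw [List.getElem?_append_left (by simp)]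
      fin_cases r <;> rfl
    | succ q =>
      rw [List.getElem?_append_right (by simp; omega), List.getElem?_cons_succ, ← ih q,
        List.length_ofFn, show 3 * (q + 1) + (r : ℕ) - 3 = 3 * q + r by omega]

theorem letterAt_onWord (τ : A → Fin 3 → A) (w : List A) (q : ℤ) (r : Fin 3) :
    letterAt (onWord τ w) (3 * q + r) = (letterAt w q).map (τ · r) := by
  rcases lt_or_ge q 0 with hq | hq
  · rw [letterAt_of_neg _ (by omega), letterAt_of_neg _ hq, Option.map_none]
  · lift q to ℕ using hq
    exact_mod_cast getElem?_onWord τ w q r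

/-- The word `w`, with its position `P` placed at the origin, agrees with `x` on `[-l, l]`. -/
def MatchesAt (x : ℤ → A) (l : ℕ) (w : List A) (P : ℤ) : Prop :=
  ∀ j : ℤ, j.natAbs ≤ l → letterAt w (P + j) = some (x j)

theorem MatchesAt.mono {l l' : ℕ} {w : List A} {P : ℤ} (h : MatchesAt x l w P) (hl : l' ≤ l) :
    MatchesAt x l' w P :=
  fun j hj => h j (hj.trans hl)

theorem exists_matchesAt_of_subword_isInfix {l : ℕ} {w : List A}
    (h : subword x (-l) (2 * l + 1) <:+: w) : ∃ P, MatchesAt x l w P := by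
  obtain ⟨p, -, hp⟩ := List.infix_iff_getElem?.1 h
  refine ⟨p + l, fun j hj => ?_⟩
  have hletter := hp (j + l).toNat (by simp only [subword, List.length_ofFn]; omega)
  rw [show (p : ℤ) + l + j = ((j + l).toNat + p : ℕ) by omega, letterAt_natCast, hletter]
  simp only [subword, List.getElem_ofFn]
  congr 2
  omega

theorem MatchesAt.subword_isInfix {L l : ℕ} {i : ℤ} {w : List A} {P : ℤ} (h : MatchesAt x L w P)
    (hi : i.natAbs + l ≤ L) : subword x i l <:+: w := by
  have hlow := (bounds_of_letterAt_eq_some (h i (by omega))).1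
  have hhigh := (bounds_of_letterAt_eq_some (h (i + l) (by omega))).2
  refine List.infix_iff_getElem?.2 ⟨(P + i).toNat, ?_, fun j hj => ?_⟩
  · rw [subword, List.length_ofFn]
    omega
  · rw [subword, List.length_ofFn] at hj
    have hletter := h (i + j) (by omega)
    rw [show P + (i + j) = (j + (P + i).toNat : ℕ) by omega, letterAt_natCast] at hletter
    simpa only [subword, List.getElem_ofFn] using hletter

theorem mem_substShift_iff :
    x ∈ substShift τ ↔
      ∀ l : ℕ, ∃ (k : ℕ) (a : A) (P : ℤ), MatchesAt x l ((onWord τ)^[k] [a]) P := by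
  constructor
  · intro hx l
    obtain ⟨k, a, h⟩ := hx (-l) (2 * l + 1)
    exact ⟨k, a, exists_matchesAt_of_subword_isInfix h⟩
  · intro hx i l
    obtain ⟨k, a, P, h⟩ := hx (i.natAbs + l)
    exact ⟨k, a, h.subword_isInfix le_rfl⟩

end Words

section FixedSeq

variable {A B : Type*}

/-- The two-sided sequence `x` with `x = T (τ(x))` and `x₀ = a`, for a letter `a` which is the
middle letter of `τ(a)`. -/
def fixedSeq (τ : A → Fin 3 → A) (a : A) (j : ℤ) : A :=
  if j = 0 then a else τ (fixedSeq τ a ((j + 1) / 3)) ⟨((j + 1) % 3).toNat, by omega⟩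
termination_by j.natAbs
decreasing_by omega

variable {τ : A → Fin 3 → A} {a : A}

theorem fixedSeq_zero : fixedSeq τ a 0 = a := by
  rw [fixedSeq, if_pos rfl]

theorem fixedSeq_apply (ha : τ a 1 = a) {j q : ℤ} {r : Fin 3} (h : j + 1 = 3 * q + r) :
    fixedSeq τ a j = τ (fixedSeq τ a q) r := by
  by_cases hj : j = 0
  · obtain rfl : q = 0 := by omega
    obtain rfl : r = 1 := by omega
    rw [hj, fixedSeq_zero, ha]
  · have hq : (j + 1) / 3 = q := by omega
    have hr : (⟨((j + 1) % 3).toNat, by omega⟩ : Fin 3) = r := Fin.ext (by simp only; omega)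
    rw [fixedSeq, if_neg hj, hr, hq]

theorem comp_fixedSeq {σ : B → Fin 3 → B} {f : A → B} (hf : ∀ a r, f (τ a r) = σ (f a) r) :
    f ∘ fixedSeq τ a = fixedSeq σ (f a) := by
  have apply_eq (j : ℤ) : f (fixedSeq τ a j) = fixedSeq σ (f a) j := by
    induction j using fixedSeq.induct with
    | case1 => rw [fixedSeq_zero, fixedSeq_zero]
    | case2 j hj ih =>
      rw [fixedSeq, if_neg hj, hf, ih]
      conv_rhs => rw [fixedSeq, if_neg hj]
  exact funext apply_eq

/-- The growing windows `τ^k(a)`, centred at the origin, exhaust the fixed sequence. -/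
theorem exists_le_matchesAt_fixedSeq (ha : τ a 1 = a) (k : ℕ) :
    ∃ c : ℕ, k ≤ c ∧ MatchesAt (fixedSeq τ a) c ((onWord τ)^[k] [a]) c := by
  induction k with
  | zero =>
    refine ⟨0, le_rfl, fun j hj => ?_⟩
    obtain rfl : j = 0 := by omega
    rw [fixedSeq_zero]
    rfl
  | succ k ih =>
    obtain ⟨c, hkc, hc⟩ := ih
    refine ⟨3 * c + 1, by omega, fun j hj => ?_⟩
    obtain ⟨q, r, hqr⟩ := exists_eq_three_mul_add (j + 1)
    rw [Function.iterate_succ_apply', show ((3 * c + 1 : ℕ) : ℤ) + j = 3 * (c + q) + r by omega,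
      letterAt_onWord, hc q (by omega), Option.map_some, fixedSeq_apply ha hqr]

theorem fixedSeq_mem_substShift (ha : τ a 1 = a) : fixedSeq τ a ∈ substShift τ :=
  mem_substShift_iff.2 fun l =>
    let ⟨c, hlc, hc⟩ := exists_le_matchesAt_fixedSeq ha l
    ⟨l, a, c, hc.mono hlc⟩

end FixedSeq

section Desubstitution

variable {A : Type*} {τ : A → Fin 3 → A} {c : A} {x y : ℤ → A}

/-- The substitutions `τ(a) = a c b` whose last letter `b` is never `c`. The position of the letter
`c` then tells where in a sequence the blocks `τ(a)` begin. -/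
structure IsMarked (τ : A → Fin 3 → A) (c : A) : Prop where
  apply_zero : ∀ a, τ a 0 = a
  apply_one : ∀ a, τ a 1 = c
  apply_two_ne : ∀ a, τ a 2 ≠ c

variable [DecidableEq A]

/-- The first digit of a point of a marked substitution shift, read off from three letters. -/
def firstDigit (c : A) (x : ℤ → A) : Fin 3 :=
  if x 1 = c ∧ x 2 ≠ c then 0 else if x 0 = c ∧ x 1 ≠ c then 1 else 2

/-- The point `y` with `T^{-δ} x = τ(y)`, where `δ` is the first digit of `x`. -/
def desubst (c : A) (x : ℤ → A) : ℤ → A :=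
  fun q => x (3 * q - (firstDigit c x : ℕ))

/-- The sequence of digits of a point of a marked substitution shift. -/
def digits (c : A) (x : ℤ → A) (i : ℕ) : Fin 3 := firstDigit c ((desubst c)^[i] x)

theorem IsMarked.firstDigit_eq (hτ : IsMarked τ c) {d : Fin 3}
    (h : ∀ i ∈ Set.Icc (0 : ℤ) 2, ∀ (q : ℤ) (r : Fin 3), i + d = 3 * q + r → ∃ b, x i = τ b r) :
    firstDigit c x = d := by
  have eq_marker (i : ℤ) (hi : i ∈ Set.Icc (0 : ℤ) 2) (q : ℤ) (hq : i + d = 3 * q + 1) :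
      x i = c := by
    obtain ⟨b, hb⟩ := h i hi q 1 hq
    rw [hb, hτ.apply_one]
  have ne_marker (i : ℤ) (hi : i ∈ Set.Icc (0 : ℤ) 2) (q : ℤ) (hq : i + d = 3 * q + 2) :
      x i ≠ c := by
    obtain ⟨b, hb⟩ := h i hi q 2 hq
    exact hb ▸ hτ.apply_two_ne b
  fin_cases d
  · simp [firstDigit, eq_marker 1 (by simp) 0 (by simp), ne_marker 2 (by simp) 0 (by simp)]
  · simp [firstDigit, eq_marker 0 (by simp) 0 (by simp), ne_marker 1 (by simp) 0 (by simp)]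
  · simp [firstDigit, eq_marker 2 (by simp) 1 (by simp), ne_marker 0 (by simp) 0 (by simp)]

theorem IsMarked.firstDigit_shift_onSeq (hτ : IsMarked τ c) (y : ℤ → A) (d : Fin 3) :
    firstDigit c (shift^[(d : ℕ)] (onSeq τ y)) = d :=
  hτ.firstDigit_eq fun i _ q r h => ⟨y q, eq_shift_iterate_onSeq_iff.1 rfl i q r h⟩

theorem IsMarked.desubst_shift_onSeq (hτ : IsMarked τ c) (y : ℤ → A) (d : Fin 3) :
    desubst c (shift^[(d : ℕ)] (onSeq τ y)) = y := by
  funext q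
  rw [desubst, hτ.firstDigit_shift_onSeq,
    eq_shift_iterate_onSeq_iff.1 rfl (3 * q - (d : ℕ)) q 0 (by simp), hτ.apply_zero]

theorem IsMarked.exists_matchesAt_onWord (hτ : IsMarked τ c) (hx : x ∈ substShift τ) (l : ℕ) :
    ∃ (k : ℕ) (a : A) (Q : ℤ),
      MatchesAt x l (onWord τ ((onWord τ)^[k] [a])) (3 * Q + (firstDigit c x : ℕ)) := by
  obtain ⟨k, a, P, hP⟩ := mem_substShift_iff.1 hx (l + 2)
  obtain ⟨Q, d, rfl⟩ := exists_eq_three_mul_add P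
  cases k with
  | zero =>
    have hleft := bounds_of_letterAt_eq_some (hP (-1) (by omega))
    have hright := bounds_of_letterAt_eq_some (hP 1 (by omega))
    simp only [Function.iterate_zero, id_eq, List.length_singleton] at hleft hright
    omega
  | succ k =>
    rw [Function.iterate_succ_apply'] at hP
    have hd : firstDigit c x = d := hτ.firstDigit_eq fun i hi q r h => by
      have hletter := hP i (by have := hi.1; have := hi.2; omega)
      rw [show 3 * Q + (d : ℤ) + i = 3 * (Q + q) + r by omega, letterAt_onWord,
        Option.map_eq_some_iff] at hletter
      obtain ⟨b, -, hb⟩ := hletter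
      exact ⟨b, hb.symm⟩
    exact ⟨k, a, Q, hd ▸ hP.mono (Nat.le_add_right l 2)⟩

theorem IsMarked.letterAt_of_matchesAt_onWord (hτ : IsMarked τ c) {l : ℕ} {w : List A} {Q q : ℤ}
    (h : MatchesAt x l (onWord τ w) (3 * Q + (firstDigit c x : ℕ))) (hq : 3 * q.natAbs + 2 ≤ l) :
    letterAt w (Q + q) = some (desubst c x q) := by
  have hletter := h (3 * q - (firstDigit c x : ℕ)) (by omega)
  rw [show 3 * Q + ((firstDigit c x : ℕ) : ℤ) + (3 * q - (firstDigit c x : ℕ)) =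
    3 * (Q + q) + ((0 : Fin 3) : ℕ) by simp; ring, letterAt_onWord] at hletter
  simpa only [hτ.apply_zero, Option.map_id', desubst] using hletter

theorem IsMarked.desubst_mem (hτ : IsMarked τ c) (hx : x ∈ substShift τ) :
    desubst c x ∈ substShift τ := by
  refine mem_substShift_iff.2 fun l => ?_
  obtain ⟨k, a, Q, h⟩ := hτ.exists_matchesAt_onWord hx (3 * l + 2)
  exact ⟨k, a, Q, fun q hq => hτ.letterAt_of_matchesAt_onWord h (by omega)⟩

theorem IsMarked.eq_shift_onSeq_desubst (hτ : IsMarked τ c) (hx : x ∈ substShift τ) :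
    x = shift^[(firstDigit c x : ℕ)] (onSeq τ (desubst c x)) := by
  refine eq_shift_iterate_onSeq_iff.2 fun i q r hqr => ?_
  obtain ⟨k, a, Q, h⟩ := hτ.exists_matchesAt_onWord hx (3 * q.natAbs + i.natAbs + 2)
  have hletter := h i (by omega)
  rw [show 3 * Q + ((firstDigit c x : ℕ) : ℤ) + i = 3 * (Q + q) + r by omega, letterAt_onWord,
    hτ.letterAt_of_matchesAt_onWord h (by omega)] at hletter
  exact (Option.some.inj hletter).symm

theorem IsMarked.isDigitSeq_digits (hτ : IsMarked τ c) (hx : x ∈ substShift τ) :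
    IsDigitSeq τ x (digits c x) := by
  have hmem (i : ℕ) : (desubst c)^[i] x ∈ substShift τ :=
    Set.MapsTo.iterate (fun _ => hτ.desubst_mem) i hx
  refine ⟨fun i => (desubst c)^[i] x, rfl, hmem, fun i => ?_⟩
  simp only [Function.iterate_succ_apply']
  exact hτ.eq_shift_onSeq_desubst (hmem i)

theorem IsMarked.eq_digits (hτ : IsMarked τ c) {δ : ℕ → Fin 3} (h : IsDigitSeq τ x δ) :
    δ = digits c x := by
  obtain ⟨y, rfl, -, hy⟩ := h
  have hiterate (i : ℕ) : (desubst c)^[i] (y 0) = y i := by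
    induction i with
    | zero => rfl
    | succ i ih => rw [Function.iterate_succ_apply', ih, hy i, hτ.desubst_shift_onSeq]
  funext i
  rw [digits, hiterate, hy i, hτ.firstDigit_shift_onSeq]

section Continuity

variable [TopologicalSpace A] [DiscreteTopology A]

theorem continuous_firstDigit (c : A) : Continuous (firstDigit c) := by
  have hletters : Continuous fun x : ℤ → A => (x 0, x 1, x 2) := by fun_prop
  exact (continuous_of_discreteTopology (f := fun u : A × A × A =>
    if u.2.1 = c ∧ u.2.2 ≠ c then (0 : Fin 3) else if u.1 = c ∧ u.2.1 ≠ c then 1 else 2)).comp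
      hletters

theorem continuous_desubst (c : A) : Continuous (desubst c) := by
  refine continuous_pi fun q => ?_
  have hletters : Continuous fun x : ℤ → A =>
      (firstDigit c x, fun d : Fin 3 => x (3 * q - (d : ℕ))) :=
    (continuous_firstDigit c).prodMk (by fun_prop)
  exact (continuous_of_discreteTopology (f := fun u : Fin 3 × (Fin 3 → A) => u.2 u.1)).comp hletters

theorem continuous_digits (c : A) : Continuous (digits c) :=
  continuous_pi fun i => (continuous_firstDigit c).comp ((continuous_desubst c).iterate i)

end Continuity

end Desubstitution

section DigitSum

variable {p : ℕ} [hp : Fact p.Prime]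

/-- The `p`-adic integer with the given digits. -/
noncomputable def digitSum (δ : ℕ → Fin p) : ℤ_[p] := ∑' i, ((δ i : ℕ) : ℤ_[p]) * (p : ℤ_[p]) ^ i

theorem norm_digit_mul_pow_le (d : Fin p) (i : ℕ) :
    ‖((d : ℕ) : ℤ_[p]) * (p : ℤ_[p]) ^ i‖ ≤ ((p : ℝ)⁻¹) ^ i := by
  rw [norm_mul, norm_pow, PadicInt.norm_p]
  exact mul_le_of_le_one_left (by positivity) (PadicInt.norm_le_one _)

variable (p) in
theorem summable_inv_pow_of_prime : Summable fun i : ℕ => ((p : ℝ)⁻¹) ^ i :=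
  summable_geometric_of_lt_one (by positivity) (inv_lt_one_of_one_lt₀ (mod_cast hp.out.one_lt))

theorem hasSum_digitSum (δ : ℕ → Fin p) :
    HasSum (fun i => ((δ i : ℕ) : ℤ_[p]) * (p : ℤ_[p]) ^ i) (digitSum δ) :=
  ((summable_inv_pow_of_prime p).of_norm_bounded fun i => norm_digit_mul_pow_le (δ i) i).hasSum

theorem continuous_digitSum : Continuous (digitSum : (ℕ → Fin p) → ℤ_[p]) :=
  continuous_tsum
    (fun i => ((continuous_of_discreteTopology (f := fun d : Fin p => ((d : ℕ) : ℤ_[p]))).comp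
      (continuous_apply i)).mul continuous_const)
    (summable_inv_pow_of_prime p) fun i δ => norm_digit_mul_pow_le (δ i) i

theorem digitSum_eq_add_mul (δ : ℕ → Fin p) :
    digitSum δ = (δ 0 : ℕ) + p * digitSum fun i => δ (i + 1) := by
  rw [digitSum, (hasSum_digitSum δ).summable.tsum_eq_zero_add, digitSum,
    ← (hasSum_digitSum _).summable.tsum_mul_left]
  simp only [pow_zero, mul_one, pow_succ', mul_left_comm]

theorem pow_dvd_sub_digitSum {δ : ℕ → Fin p} {z : ℕ → ℤ_[p]}
    (hz : ∀ k, z k = (δ k : ℕ) + p * z (k + 1)) (n : ℕ) :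
    (p : ℤ_[p]) ^ n ∣ z 0 - digitSum δ := by
  induction n generalizing δ z with
  | zero => simp
  | succ n ih =>
    have hstep : z 0 - digitSum δ = p * (z 1 - digitSum fun i => δ (i + 1)) := by
      rw [hz 0, digitSum_eq_add_mul δ]
      ring
    rw [hstep, pow_succ']
    exact mul_dvd_mul_left _ (ih fun k => hz (k + 1))

theorem digitSum_eq_of_forall_eq_add_mul {δ : ℕ → Fin p} {z : ℕ → ℤ_[p]}
    (hz : ∀ k, z k = (δ k : ℕ) + p * z (k + 1)) : digitSum δ = z 0 := by
  by_contra hne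
  obtain ⟨n, hn⟩ :=
    FiniteMultiplicity.of_prime_left PadicInt.prime_p (sub_ne_zero.2 (Ne.symm hne))
  exact hn (pow_dvd_sub_digitSum hz (n + 1))

theorem digit_zero_eq_of_digitSum_eq {δ ε : ℕ → Fin p} (h : digitSum δ = digitSum ε) :
    δ 0 = ε 0 := by
  have hmod := congrArg PadicInt.toZMod h
  rw [digitSum_eq_add_mul δ, digitSum_eq_add_mul ε] at hmod
  simp only [map_add, map_mul, map_natCast, CharP.cast_eq_zero, zero_mul, add_zero,
    ZMod.natCast_eq_natCast_iff', Nat.mod_eq_of_lt (Fin.is_lt _)] at hmod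
  exact Fin.ext hmod

theorem digitSum_injective : Function.Injective (digitSum : (ℕ → Fin p) → ℤ_[p]) := by
  intro δ ε h
  funext i
  induction i generalizing δ ε with
  | zero => exact digit_zero_eq_of_digitSum_eq h
  | succ _ ih =>
    refine ih (δ := fun i => δ (i + 1)) (ε := fun i => ε (i + 1)) ?_
    have hsum := h
    rw [digitSum_eq_add_mul δ, digitSum_eq_add_mul ε, digit_zero_eq_of_digitSum_eq h] at hsum
    exact mul_left_cancel₀ PadicInt.prime_p.ne_zero (add_left_cancel hsum)

theorem digitSum_eq_zero_iff {δ : ℕ → Fin p} : digitSum δ = 0 ↔ δ = 0 := by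
  have hzero : digitSum (0 : ℕ → Fin p) = 0 := by simp [digitSum]
  rw [← hzero, digitSum_injective.eq_iff]

theorem frequently_ne_zero_of_digitSum_ne_natCast {δ : ℕ → Fin p}
    (h : ∀ N : ℕ, digitSum δ ≠ N) : ∃ᶠ k in atTop, δ k ≠ 0 := by
  rw [frequently_atTop]
  by_contra! hzero
  obtain ⟨K, hK⟩ := hzero
  refine h (∑ i ∈ Finset.range K, (δ i : ℕ) * p ^ i) ?_
  rw [digitSum, tsum_eq_sum (s := Finset.range K)]
  · push_cast
    rfl
  · intro k hk
    rw [hK k (by simpa using hk)]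
    simp

end DigitSum

section Address

/-- The position in `x^{(k)}` of the block image containing position `j` of `x`, when `x` has the
digits `δ`: one desubstitution with digit `d` sends position `i` to `⌊(i + d) / 3⌋`. -/
def position (δ : ℕ → Fin 3) (j : ℤ) : ℕ → ℤ
  | 0 => j
  | k + 1 => (position δ j k + (δ k : ℕ)) / 3

/-- The places, within the blocks of the successive levels, of the letter in position `j` of a point
with digits `δ`. They are also the digits of the `j`-th translate of that point. -/
def address (δ : ℕ → Fin 3) (j : ℤ) (k : ℕ) : Fin 3 :=
  ⟨((position δ j k + (δ k : ℕ)) % 3).toNat, by omega⟩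

theorem position_add_digit (δ : ℕ → Fin 3) (j : ℤ) (k : ℕ) :
    position δ j k + (δ k : ℕ) = 3 * position δ j (k + 1) + (address δ j k : ℕ) := by
  simp only [position, address]
  omega

theorem digitSum_address (δ : ℕ → Fin 3) (j : ℤ) :
    digitSum (address δ j) = digitSum δ + j := by
  have hz (k : ℕ) : digitSum (fun i => δ (i + k)) + position δ j k = (address δ j k : ℕ) +
      (3 : ℕ) * (digitSum (fun i => δ (i + (k + 1))) + position δ j (k + 1)) := by
    have hdiv := congrArg (Int.cast (R := ℤ_[3])) (position_add_digit δ j k)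
    rw [digitSum_eq_add_mul fun i => δ (i + k)]
    simp only [zero_add, add_assoc, add_comm 1 k]
    push_cast at hdiv ⊢
    linear_combination hdiv
  exact digitSum_eq_of_forall_eq_add_mul hz

variable {A B : Type*} {τ : A → Fin 3 → A} {σ : B → Fin 3 → B} {f : A → B} {x x' : ℤ → A}
  {δ : ℕ → Fin 3}

theorem IsDigitSeq.comp (hf : ∀ a r, f (τ a r) = σ (f a) r) (h : IsDigitSeq τ x δ) :
    IsDigitSeq σ (f ∘ x) δ := by
  obtain ⟨y, rfl, hmem, hy⟩ := h
  refine ⟨fun k => f ∘ y k, rfl, fun k => comp_mem_substShift hf (hmem k), fun k => ?_⟩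
  refine eq_shift_iterate_onSeq_iff.2 fun i q r hqr => ?_
  simp only [Function.comp_apply, eq_shift_iterate_onSeq_iff.1 (hy k) i q r hqr, hf]

theorem IsDigitSeq.translate (h : IsDigitSeq τ x δ) (j : ℤ) :
    IsDigitSeq τ (fun i => x (i + j)) (address δ j) := by
  obtain ⟨y, rfl, hmem, hy⟩ := h
  refine ⟨fun k i => y k (i + position δ j k), rfl,
    fun k => translate_mem_substShift (hmem k) _, fun k => ?_⟩
  refine eq_shift_iterate_onSeq_iff.2 fun i q r hqr => ?_
  refine eq_shift_iterate_onSeq_iff.1 (hy k) _ _ r ?_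
  have hdiv := position_add_digit δ j k
  omega

theorem IsMarked.digitSum_digits_shift [DecidableEq A] {c : A} (hτ : IsMarked τ c)
    (hx : x ∈ substShift τ) :
    digitSum (digits c (shift x)) = digitSum (digits c x) + 1 := by
  have haddr : address (digits c x) 1 = digits c (shift x) :=
    hτ.eq_digits ((hτ.isDigitSeq_digits hx).translate 1)
  rw [← haddr, digitSum_address, Int.cast_one]

theorem IsDigitSeq.apply_natCast_eq_of_zero (hτ : ∀ a, τ a 0 = a) (h : IsDigitSeq τ x 0)
    (h' : IsDigitSeq τ x' 0) (h0 : x 0 = x' 0) (N : ℕ) : x N = x' N := by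
  obtain ⟨y, rfl, -, hy⟩ := h
  obtain ⟨y', rfl, -, hy'⟩ := h'
  have block {z : ℕ → ℤ → A}
      (hz : ∀ k, z k = shift^[((0 : ℕ → Fin 3) k : ℕ)] (onSeq τ (z (k + 1))))
      (k : ℕ) (q : ℤ) (r : Fin 3) : z k (3 * q + r) = τ (z (k + 1) q) r :=
    eq_shift_iterate_onSeq_iff.1 (hz k) _ q r (by simp)
  have origin (k : ℕ) : y k 0 = y' k 0 := by
    induction k with
    | zero => exact h0
    | succ k ih =>
      have hletter := block hy k 0 0
      have hletter' := block hy' k 0 0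
      simp only [Fin.val_zero, Nat.cast_zero, mul_zero, add_zero, hτ] at hletter hletter'
      rw [← hletter, ← hletter', ih]
  suffices ∀ k, y k N = y' k N from this 0
  induction N using Nat.strong_induction_on with
  | _ N ih =>
    intro k
    rcases Nat.eq_zero_or_pos N with rfl | hN
    · exact origin k
    · obtain ⟨r, hr⟩ : ∃ r : Fin 3, (N : ℤ) = 3 * (N / 3 : ℕ) + r :=
        ⟨⟨N % 3, by omega⟩, by simp only; omega⟩
      rw [hr, block hy, block hy', ih (N / 3) (by omega)]

end Address

section Tau

variable {n : ℕ}

theorem val_tau_two (a : Fin (n + 1)) : (tau n a 2 : ℕ) = min ((a : ℕ) + 1) n := by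
  by_cases h : (a : ℕ) < n
  · simp [tau, h]
  · have ha : (a : ℕ) = n := by omega
    simp [tau, ha]

theorem isMarked_tau (hn : 1 ≤ n) : IsMarked (tau n) 0 where
  apply_zero _ := rfl
  apply_one _ := rfl
  apply_two_ne a h := by
    have hval := val_tau_two a
    rw [h, Fin.val_zero] at hval
    omega

theorem val_rho (a : Fin (n + 1 + 1)) : (rho n a : ℕ) = min (a : ℕ) n := by
  unfold rho
  split_ifs with h
  · simp only
    omega
  · simp only [Fin.val_last]
    omega

theorem rho_tau (a : Fin (n + 1 + 1)) (r : Fin 3) :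
    rho n (tau (n + 1) a r) = tau n (rho n a) r := by
  fin_cases r
  · rfl
  · exact Fin.ext (by simp [val_rho, tau])
  · refine Fin.ext ?_
    simp only [Fin.reduceFinMk, val_rho, val_tau_two]
    omega

theorem forall_of_frequently_of_succ {P : ℕ → Prop} (hP : ∃ᶠ k in atTop, P k)
    (hsucc : ∀ k, P (k + 1) → P k) (k : ℕ) : P k := by
  obtain ⟨m, hkm, hm⟩ := frequently_atTop.1 hP k
  have hanti : Antitone P := antitone_nat_of_succ_le hsucc
  exact hanti hkm hm

/-- Compare the letters truncated at `c`: the middle letter of a block does not depend on the letter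
substituted, and passing to the last letter of a block gains one unit of truncation. -/
theorem min_eq_min_of_forall_eq_tau {ε : ℕ → Fin 3} {a a' : ℕ → Fin (n + 1)}
    (ha : ∀ k, a k = tau n (a (k + 1)) (ε k)) (ha' : ∀ k, a' k = tau n (a' (k + 1)) (ε k))
    (hε : ∃ᶠ k in atTop, ε k ≠ 0) (c k : ℕ) : min (a k : ℕ) c = min (a' k : ℕ) c := by
  have tau_zero (k : ℕ) (hk : ε k = 0) : a k = a (k + 1) ∧ a' k = a' (k + 1) := by
    rw [ha k, ha' k, hk]
    exact ⟨rfl, rfl⟩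
  have tau_one (k : ℕ) (hk : ε k = 1) : a k = a' k := by
    rw [ha k, ha' k, hk]
    rfl
  have tau_two (k : ℕ) (hk : ε k = 2) :
      (a k : ℕ) = min ((a (k + 1) : ℕ) + 1) n ∧ (a' k : ℕ) = min ((a' (k + 1) : ℕ) + 1) n := by
    rw [ha k, ha' k, hk]
    exact ⟨val_tau_two _, val_tau_two _⟩
  have cases_digit (d : Fin 3) : d = 0 ∨ d = 1 ∨ d = 2 := by omega
  induction c generalizing k with
  | zero => simp
  | succ c ih =>
    refine forall_of_frequently_of_succ
      (P := fun k => min (a k : ℕ) (c + 1) = min (a' k : ℕ) (c + 1))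
      (hε.mono fun k hk => ?_) (fun k heq => ?_) k
    · rcases cases_digit (ε k) with h | h | h
      · exact absurd h hk
      · rw [tau_one k h]
      · have := ih (k + 1)
        have := tau_two k h
        omega
    · rcases cases_digit (ε k) with h | h | h
      · rw [(tau_zero k h).1, (tau_zero k h).2, heq]
      · rw [tau_one k h]
      · have := tau_two k h
        omega

theorem eq_of_forall_eq_tau {ε : ℕ → Fin 3} {a a' : ℕ → Fin (n + 1)}
    (ha : ∀ k, a k = tau n (a (k + 1)) (ε k)) (ha' : ∀ k, a' k = tau n (a' (k + 1)) (ε k))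
    (hε : ∃ᶠ k in atTop, ε k ≠ 0) (k : ℕ) : a k = a' k := by
  have hmin := min_eq_min_of_forall_eq_tau ha ha' hε n k
  rwa [min_eq_left (Fin.is_le _), min_eq_left (Fin.is_le _), ← Fin.ext_iff] at hmin

variable {x x' : ℤ → Fin (n + 1)} {δ : ℕ → Fin 3}

theorem IsDigitSeq.apply_zero_eq (h : IsDigitSeq (tau n) x δ) (h' : IsDigitSeq (tau n) x' δ)
    (hδ : ∀ N : ℕ, digitSum δ ≠ N) : x 0 = x' 0 := by
  obtain ⟨y, rfl, -, hy⟩ := h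
  obtain ⟨y', rfl, -, hy'⟩ := h'
  exact eq_of_forall_eq_tau
    (fun k => eq_shift_iterate_onSeq_iff.1 (hy k) 0 0 (δ k) (by simp))
    (fun k => eq_shift_iterate_onSeq_iff.1 (hy' k) 0 0 (δ k) (by simp))
    (frequently_ne_zero_of_digitSum_ne_natCast hδ) 0

theorem IsDigitSeq.eq_of_apply_eq (h : IsDigitSeq (tau n) x δ) (h' : IsDigitSeq (tau n) x' δ)
    (hxx' : ∀ m : ℤ, digitSum δ + m = 0 → x m = x' m) : x = x' := by
  funext j
  by_cases hj : ∃ N : ℕ, digitSum δ + j = N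
  · obtain ⟨N, hN⟩ := hj
    have hm : digitSum δ + (j - N : ℤ) = 0 := by
      push_cast
      linear_combination hN
    have haddr : address δ (j - N) = 0 := digitSum_eq_zero_iff.1 ((digitSum_address _ _).trans hm)
    have hletter := (haddr ▸ h.translate (j - N)).apply_natCast_eq_of_zero (fun _ => rfl)
      (haddr ▸ h'.translate (j - N)) (by simpa only [zero_add] using hxx' _ hm) N
    simpa only [add_sub_cancel] using hletter
  · push Not at hj
    have hletter := (h.translate j).apply_zero_eq (h'.translate j)
      (by simpa only [digitSum_address] using hj)
    simpa only [zero_add] using hletter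

end Tau

section Dynamics

theorem surjective_of_semiconj_add_one {p : ℕ} [Fact p.Prime] {X : Type*} [TopologicalSpace X]
    [CompactSpace X] [Nonempty X] {T : X → X} {f : X → ℤ_[p]} (hf : Continuous f)
    (hT : Function.Semiconj f T (· + 1)) : Function.Surjective f := by
  obtain ⟨x⟩ := ‹Nonempty X›
  have htranslates : DenseRange fun k : ℕ => f x + (k : ℤ_[p]) :=
    (Homeomorph.addLeft (f x)).surjective.denseRange.comp PadicInt.denseRange_natCast
      (Homeomorph.addLeft (f x)).continuous
  have hdense : DenseRange f := htranslates.mono <| by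
    rintro _ ⟨k, rfl⟩
    exact ⟨T^[k] x, by simpa using hT.iterate_right k x⟩
  rw [← Set.range_eq_univ, ← hdense.closure_range,
    (isCompact_range hf).isClosed.closure_eq]

variable {X Y : Type*} [t : TopologicalSpace X] [CompactSpace X] [MetricSpace Y]
  {m : MetricSpace X} {T : X → X} {S : Y → Y} {f : X → Y}

theorem IsLiYorkePair.map_eq (hm : IsCompatible m t) (hf : Continuous f) (hS : Isometry S)
    (hT : Function.Semiconj f T S) {x y : X} (h : IsLiYorkePair m T x y) : f x = f y := by
  unfold IsCompatible at hm
  subst hm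
  by_contra hne
  obtain ⟨δ, hδ, hclose⟩ := EMetric.uniformContinuous_iff.1
    (CompactSpace.uniformContinuous_of_continuous hf) (edist (f x) (f y)) (edist_pos.2 hne)
  have hliminf : liminf (fun n : ℕ => edist (T^[n] x) (T^[n] y)) atTop < δ := h.2 ▸ hδ
  obtain ⟨k, hk⟩ := (frequently_lt_of_liminf_lt (by isBoundedDefault) hliminf).exists
  have hconst (n : ℕ) : edist (f (T^[n] x)) (f (T^[n] y)) = edist (f x) (f y) := by
    induction n with
    | zero => rfl
    | succ n ih =>
      rw [Function.iterate_succ_apply', Function.iterate_succ_apply', hT, hT, hS.edist_eq, ih]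
  exact (hclose hk).ne (hconst k)

theorem IsScrambled.countable (hm : IsCompatible m t) (hf : Continuous f) (hS : Isometry S)
    (hT : Function.Semiconj f T S) (hfiber : ∀ z, (f ⁻¹' {z}).Countable) {s : Set X}
    (hs : IsScrambled m T s) : s.Countable := by
  rcases s.eq_empty_or_nonempty with rfl | ⟨x, hx⟩
  · exact Set.countable_empty
  · refine (hfiber (f x)).mono fun y hy => ?_
    rcases eq_or_ne y x with rfl | hne
    · rfl
    · exact (hs hy hx hne).map_eq hm hf hS hT

end Dynamics

section CompatibleLetters

variable {b : ∀ k : ℕ, Fin (k + 1 + 1)}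

theorem val_eq_min_of_rho (hb : ∀ k, rho (k + 1) (b (k + 1)) = b k) {k m : ℕ} (hkm : k ≤ m) :
    (b k : ℕ) = min (b m : ℕ) (k + 1) := by
  induction m, hkm using Nat.le_induction with
  | base => exact (min_eq_left (Fin.is_le _)).symm
  | succ m hkm ih =>
    rw [ih, ← hb m, val_rho]
    omega

theorem val_eq_min_iSup_of_rho (hb : ∀ k, rho (k + 1) (b (k + 1)) = b k) (k : ℕ) :
    ((b k : ℕ) : ℕ∞) = min (⨆ m, ((b m : ℕ) : ℕ∞)) ((k + 1 : ℕ) : ℕ∞) := by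
  apply le_antisymm
  · exact le_min (le_iSup (fun m => ((b m : ℕ) : ℕ∞)) k) (mod_cast Fin.is_le (b k))
  · rw [iSup_inf_eq]
    refine iSup_le fun m => ?_
    rw [← (Nat.mono_cast (α := ℕ∞)).map_min]
    norm_cast
    rcases le_total k m with h | h
    · exact (val_eq_min_of_rho hb h).ge
    · have hmk := val_eq_min_of_rho hb h
      omega

theorem countable_setOf_rho_eq :
    {b : ∀ k : ℕ, Fin (k + 1 + 1) | ∀ k, rho (k + 1) (b (k + 1)) = b k}.Countable := by
  refine Set.MapsTo.countable_of_injOn (f := fun b => ⨆ k, ((b k : ℕ) : ℕ∞))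
    (Set.mapsTo_univ _ _) (fun b hb b' hb' hsup => ?_) Set.countable_univ
  funext k
  have hval := val_eq_min_iSup_of_rho hb k
  simp only at hsup
  rw [hsup, ← val_eq_min_iSup_of_rho hb' k] at hval
  exact Fin.ext (mod_cast hval)

end CompatibleLetters

section InvLimit

theorem isClosed_invLimit : IsClosed invLimit := by
  have heq : invLimit = (⋂ k, {x | x k ∈ substShift (tau (k + 1))}) ∩
      ⋂ k, {x | (fun i => rho (k + 1) (x (k + 1) i)) = x k} := by
    ext x
    simp only [invLimit, Set.mem_inter_iff, Set.mem_iInter, Set.mem_ofPred_eq]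
  rw [heq]
  refine (isClosed_iInter fun k => ?_).inter (isClosed_iInter fun k => ?_)
  · exact (isClosed_substShift _).preimage (continuous_apply k)
  · refine isClosed_eq (continuous_pi fun i => ?_) (continuous_apply k)
    exact (continuous_of_discreteTopology (f := rho (k + 1))).comp
      ((continuous_apply i).comp (continuous_apply (k + 1)))

instance : CompactSpace invLimit :=
  isCompact_iff_compactSpace.1 isClosed_invLimit.isCompact

instance : Nonempty invLimit :=
  ⟨⟨fun k => fixedSeq (tau (k + 1)) 0, fun _ => fixedSeq_mem_substShift rfl,
    fun _ => comp_fixedSeq rho_tau⟩⟩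

theorem digits_invLimit (x : invLimit) (k : ℕ) : digits 0 (x.1 k) = digits 0 (x.1 0) := by
  induction k with
  | zero => rfl
  | succ k ih =>
    have hdigits := (isMarked_tau (Nat.le_add_left 1 (k + 1))).isDigitSeq_digits (x.2.1 (k + 1))
    rw [← ih, ← x.2.2 k]
    exact (isMarked_tau (Nat.le_add_left 1 k)).eq_digits (hdigits.comp rho_tau)

/-- The factor map `π` onto the `3`-odometer. By `digits_invLimit`, any coordinate could replace the
first one here. -/
noncomputable def toOdometer (x : invLimit) : ℤ_[3] := digitSum (digits 0 (x.1 0))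

theorem isDigitSeq_invLimit (x : invLimit) (k : ℕ) :
    IsDigitSeq (tau (k + 1)) (x.1 k) (digits 0 (x.1 0)) :=
  digits_invLimit x k ▸ (isMarked_tau (Nat.le_add_left 1 k)).isDigitSeq_digits (x.2.1 k)

theorem hasSum_toOdometer {x : invLimit} {k : ℕ} {δ : ℕ → Fin 3}
    (hδ : IsDigitSeq (tau (k + 1)) (x.1 k) δ) :
    HasSum (fun i => ((δ i : ℕ) : ℤ_[3]) * 3 ^ i) (toOdometer x) := by
  obtain rfl := (isMarked_tau (Nat.le_add_left 1 k)).eq_digits hδ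
  rw [toOdometer, ← digits_invLimit x k]
  exact_mod_cast hasSum_digitSum (digits 0 (x.1 k))

theorem continuous_toOdometer : Continuous toOdometer :=
  (continuous_digitSum.comp (continuous_digits 0)).comp
    ((continuous_apply 0).comp continuous_subtype_val)

theorem semiconj_toOdometer : Function.Semiconj toOdometer invShift (· + 1) := fun x =>
  (isMarked_tau le_rfl).digitSum_digits_shift (x.2.1 0)

theorem eq_of_toOdometer_eq {x x' : invLimit} (h : toOdometer x = toOdometer x')
    (hxx' : ∀ m : ℤ, toOdometer x + m = 0 → ∀ k, x.1 k m = x'.1 k m) : x = x' := by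
  have hdigits : digits 0 (x.1 0) = digits 0 (x'.1 0) := digitSum_injective h
  exact Subtype.ext <| funext fun k => (isDigitSeq_invLimit x k).eq_of_apply_eq
    (hdigits ▸ isDigitSeq_invLimit x' k) fun m hm => hxx' m hm k

theorem countable_fiber (z : ℤ_[3]) : (toOdometer ⁻¹' {z}).Countable := by
  by_cases hz : ∃ m : ℤ, z + m = 0
  · obtain ⟨m, hm⟩ := hz
    refine Set.MapsTo.countable_of_injOn (f := fun (x : invLimit) k => x.1 k m)
      (t := {b | ∀ k, rho (k + 1) (b (k + 1)) = b k})
      (fun x _ k => congrFun (x.2.2 k) m) (fun x hx x' hx' hletters => ?_) countable_setOf_rho_eq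
    refine eq_of_toOdometer_eq (hx.trans (Eq.symm hx')) fun m' hm' => ?_
    rw [show toOdometer x = z from hx] at hm'
    obtain rfl : m' = m := Int.cast_injective (add_left_cancel (hm'.trans hm.symm))
    exact congrFun hletters
  · refine Set.Subsingleton.countable fun x hx x' hx' => ?_
    refine eq_of_toOdometer_eq (hx.trans (Eq.symm hx')) fun m hm => absurd ⟨m, ?_⟩ hz
    rwa [show toOdometer x = z from hx] at hm

end InvLimit

end SubstInvLim

open SubstInvLim in
/-- The `3`-odometer is the ring `ℤ_[3]` of `3`-adic integers (the inverse limit of the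
`ℤ / 3^k ℤ`) with the addition of `1`. The first part and the clause on digit sequences say that
`π` is the map which sends `x = (x_n)` to the `3`-adic integer whose digits are those of
any `x_n`. -/
theorem proposition4p3 :
    (∀ n : ℕ, 1 ≤ n → ∀ x ∈ substShift (tau n), ∃! δ : ℕ → Fin 3, IsDigitSeq (tau n) x δ) ∧
    ∃ π : invLimit → ℤ_[3],
      (∀ (x : invLimit) (k : ℕ) (δ : ℕ → Fin 3), IsDigitSeq (tau (k + 1)) (x.1 k) δ →
        HasSum (fun i : ℕ => ((δ i : ℕ) : ℤ_[3]) * 3 ^ i) (π x)) ∧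
      Continuous π ∧ Function.Surjective π ∧ (∀ x, π (invShift x) = π x + 1) ∧
      (∀ z : ℤ_[3], (π ⁻¹' {z}).Countable) ∧
      ∀ m : MetricSpace invLimit, IsCompatible m inferInstance →
        ∀ S : Set invLimit, IsScrambled m invShift S → S.Countable := by
  refine ⟨fun n hn x hx => ⟨digits 0 x, (isMarked_tau hn).isDigitSeq_digits hx,
      fun δ hδ => (isMarked_tau hn).eq_digits hδ⟩,
    toOdometer, fun x k δ hδ => hasSum_toOdometer hδ, continuous_toOdometer,
    surjective_of_semiconj_add_one continuous_toOdometer semiconj_toOdometer,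
    semiconj_toOdometer, countable_fiber, fun m hm S hS => ?_⟩
  exact hS.countable hm continuous_toOdometer (isometry_add_right 1) semiconj_toOdometer
    countable_fiber
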